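/- \textbf{Theorem.} Let $M$ be a smooth manifold (finite-dimensional, Hausdorff, second countable) and let $\pi : A \to M$ be a smooth real vector bundle of finite rank, with space of smooth sections $\mathsf{Sec}(A)$. Let $(A,[-,-],\rho,g,L)$ be a Carrollian Lie algebroid, that is: (a) $[-,-]$ is an $\mathbb{R}$-Lie bracket on $\mathsf{Sec}(A)$ and $\rho : A \to TM$ is a smooth vector bundle map (over the identity of $M$) with $[u, f v] = \rho_u(f)\, v + f\,[u,v]$ for all $u,v\in\mathsf{Sec}(A)$ and $f\in C^\infty(M)$; (b) $g$ is a smooth family of symmetric bilinear forms on the fibres of $A$ (equivalently, a symmetric $C^\infty(M)$-bilinear map $\mathsf{Sec}(A)\times\mathsf{Sec}(A)\to C^\infty(M)$), not assumed semidefinite; (c) $L \subset A$ is a trivial line subbundle (that is, spanned by a nowhere vanishing smooth section of $A$) which is the kernel of $g$ in every fibre: $L_x=\{a\in A_x : g_x(a,b)=0 \text{ for all } b\in A_x\}$ for every $x\in M$. A connection on $A$ is an $\mathbb{R}$-bilinear map $\nabla:\mathsf{Sec}(A)\times\mathsf{Sec}(A)\to\mathsf{Sec}(A)$ with $\nabla_{fu}v=f\nabla_u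 v$ and $\nabla_u(fv)=f\nabla_u v+\rho_u(f)v$. It is \emph{Carrollian} if $\nabla_u v\in\mathsf{Sec}(L)$ for all $u\in\mathsf{Sec}(A)$, $v\in\mathsf{Sec}(L)$, and $\rho_u(g(v,w))=g(\nabla_u v,w)+g(v,\nabla_u w)$ for all $u,v,w\in\mathsf{Sec}(A)$. It is \emph{torsion-free} if $\nabla_u v-\nabla_v u=[u,v]$ for all $u,v\in\mathsf{Sec}(A)$. Then $A$ admits a torsion-free Carrollian connection if and only if it is \emph{stationary}, i.e. every $u\in\mathsf{Sec}(L)$ is a Killing section: $\rho_u(g(v,w))=g([u,v],w)+g(v,[u,w])$ for all $v,w\in\mathsf{Sec}(A)$. -/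

import Mathlib

open Bundle
open scoped Manifold ContDiff Bundle

noncomputable section

section CarrollianDefs

variable {E : Type*} [NormedAddCommGroup E] [NormedSpace ℝ E]
  {H : Type*} [TopologicalSpace H] (I : ModelWithCorners ℝ E H)
  {M : Type*} [TopologicalSpace M] [ChartedSpace H M] [IsManifold I ∞ M]
  (F : Type*) [NormedAddCommGroup F] [NormedSpace ℝ F]
  (V : M → Type*) [TopologicalSpace (TotalSpace F V)]
  [∀ x, AddCommGroup (V x)] [∀ x, Module ℝ (V x)] [∀ x, TopologicalSpace (V x)]
  [∀ x, IsTopologicalAddGroup (V x)] [∀ x, ContinuousSMul ℝ (V x)]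
  [FiberBundle F V] [VectorBundle ℝ F V]

variable {I F V} in
/-- The product `f v` of a smooth function `f` and a smooth section `v`. -/
def smulSection (f : C^∞⟮I, M; 𝓘(ℝ, ℝ), ℝ⟯) (v : Cₛ^∞⟮I; F, V⟯) : Cₛ^∞⟮I; F, V⟯ :=
  ⟨fun x => f x • v x, f.contMDiff.smul_section v.contMDiff⟩

/-- A Lie algebroid structure on the smooth vector bundle `V → M`: an `ℝ`-Lie bracket on the space
of smooth sections and a smooth bundle map `V → TM` (the anchor), subject to the Leibniz rule
`[u, f v] = ρ_u(f) v + f [u, v]`. -/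
structure LieAlgebroid where
  bracket : Cₛ^∞⟮I; F, V⟯ →ₗ[ℝ] Cₛ^∞⟮I; F, V⟯ →ₗ[ℝ] Cₛ^∞⟮I; F, V⟯
  bracket_self : ∀ u, bracket u u = 0
  jacobi : ∀ u v w,
    bracket u (bracket v w) + bracket v (bracket w u) + bracket w (bracket u v) = 0
  anchor : ∀ x : M, V x →L[ℝ] TangentSpace I x
  contMDiff_anchor : ContMDiff I (I.prod 𝓘(ℝ, F →L[ℝ] E)) ∞
    (fun x => TotalSpace.mk' (F →L[ℝ] E)
      (E := fun x : M => V x →L[ℝ] TangentSpace I x) x (anchor x))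
  leibniz : ∀ (u v : Cₛ^∞⟮I; F, V⟯) (f : C^∞⟮I, M; 𝓘(ℝ, ℝ), ℝ⟯) (x : M),
    bracket u (smulSection f v) x = mvfderiv I f x (anchor x (u x)) • v x + f x • bracket u v x

variable {I F V} in
/-- The derivative `ρ_u(f)` of a function `f` along the vector field `ρ_u`. -/
def LieAlgebroid.anchorDeriv (A : LieAlgebroid I F V) (u : Cₛ^∞⟮I; F, V⟯) (f : M → ℝ) : M → ℝ :=
  fun x => mvfderiv I f x (A.anchor x (u x))

/-- A Lie algebroid with a (possibly degenerate) metric: a smooth family of symmetric bilinear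
forms on the fibres. No definiteness is required. -/
structure SemiRiemannianLieAlgebroid extends LieAlgebroid I F V where
  metric : ∀ x : M, V x →L[ℝ] V x →L[ℝ] ℝ
  metric_symm : ∀ (x : M) (a b : V x), metric x a b = metric x b a
  contMDiff_metric : ContMDiff I (I.prod 𝓘(ℝ, F →L[ℝ] F →L[ℝ] ℝ)) ∞
    (fun x => TotalSpace.mk' (F →L[ℝ] F →L[ℝ] ℝ)
      (E := fun x : M => V x →L[ℝ] V x →L[ℝ] ℝ) x (metric x))

namespace SemiRiemannianLieAlgebroid

variable {I F V} (A : SemiRiemannianLieAlgebroid I F V)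

/-- The function `g(u, v)` on `M`. -/
def g (u v : Cₛ^∞⟮I; F, V⟯) : M → ℝ := fun x => A.metric x (u x) (v x)

/-- `(L_u g)(v, w) = ρ_u(g(v, w)) - g([u, v], w) - g(v, [u, w])`. -/
def lieDerivMetric (u v w : Cₛ^∞⟮I; F, V⟯) : M → ℝ :=
  A.anchorDeriv u (A.g v w) - A.g (A.bracket u v) w - A.g v (A.bracket u w)

/-- `u` is a Killing section: `L_u g = 0`. -/
def IsKilling (u : Cₛ^∞⟮I; F, V⟯) : Prop := ∀ v w, A.lieDerivMetric u v w = 0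

end SemiRiemannianLieAlgebroid

variable {I F V} in
/-- A family of subspaces of the fibres is a trivial line subbundle: it is spanned by a nowhere
vanishing smooth section (a global frame). -/
def IsTrivialLineSubbundle (L : ∀ x : M, Submodule ℝ (V x)) : Prop :=
  ∃ σ : Cₛ^∞⟮I; F, V⟯, ∀ x, σ x ≠ 0 ∧ L x = Submodule.span ℝ {σ x}

/-- A Carrollian Lie algebroid: a Lie algebroid with a degenerate metric and a trivial line
subbundle `L` that is the kernel of the metric. -/
structure CarrollianLieAlgebroid extends SemiRiemannianLieAlgebroid I F V where
  L : ∀ x : M, Submodule ℝ (V x)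
  isTrivialLineSubbundle_L : IsTrivialLineSubbundle (I := I) (F := F) L
  ker_metric : ∀ (x : M) (a : V x), (∀ b : V x, metric x a b = 0) ↔ a ∈ L x

variable {I F V} in
/-- A Lie algebroid connection. -/
structure LieAlgebroid.Connection (A : LieAlgebroid I F V) where
  nabla : Cₛ^∞⟮I; F, V⟯ →ₗ[ℝ] Cₛ^∞⟮I; F, V⟯ →ₗ[ℝ] Cₛ^∞⟮I; F, V⟯
  nabla_smul_left : ∀ (f : C^∞⟮I, M; 𝓘(ℝ, ℝ), ℝ⟯) (u v : Cₛ^∞⟮I; F, V⟯),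
    nabla (smulSection f u) v = smulSection f (nabla u v)
  nabla_smul_right : ∀ (f : C^∞⟮I, M; 𝓘(ℝ, ℝ), ℝ⟯) (u v : Cₛ^∞⟮I; F, V⟯) (x : M),
    nabla u (smulSection f v) x = f x • nabla u v x + A.anchorDeriv u f x • v x

namespace LieAlgebroid.Connection

variable {I F V} {A : LieAlgebroid I F V} (D : A.Connection)

/-- The torsion `T(u, v) = ∇_u v - ∇_v u - [u, v]`. -/
def torsion (u v : Cₛ^∞⟮I; F, V⟯) : Cₛ^∞⟮I; F, V⟯ := D.nabla u v - D.nabla v u - A.bracket u v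

def IsTorsionFree : Prop := ∀ u v, D.torsion u v = 0

end LieAlgebroid.Connection

namespace CarrollianLieAlgebroid

variable {I F V} (A : CarrollianLieAlgebroid I F V)

/-- The smooth sections of `A` with values in `L`. -/
def secL : Set Cₛ^∞⟮I; F, V⟯ := {u | ∀ x, u x ∈ A.L x}

/-- Every section of `L` is Killing. -/
def IsStationary : Prop := ∀ u ∈ A.secL, A.IsKilling u

variable (D : A.toLieAlgebroid.Connection)

def IsLCompatible : Prop := ∀ u v, v ∈ A.secL → D.nabla u v ∈ A.secL

/-- `ρ_u(g(v, w)) = g(∇_u v, w) + g(v, ∇_u w)`. -/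
def IsMetricCompatible : Prop :=
  ∀ u v w, A.anchorDeriv u (A.g v w) = A.g (D.nabla u v) w + A.g v (D.nabla u w)

/-- A connection is Carrollian if it is `L`-compatible and metric compatible. -/
def IsCarrollian : Prop := A.IsLCompatible D ∧ A.IsMetricCompatible D

end CarrollianLieAlgebroid

end CarrollianDefs

end

open scoped Topology

noncomputable section

/-! ### Global frames near a point, and representing functionals by sections. -/

section Sections

variable {E : Type*} [NormedAddCommGroup E] [NormedSpace ℝ E]
  {H : Type*} [TopologicalSpace H] {I : ModelWithCorners ℝ E H}
  {M : Type*} [TopologicalSpace M] [ChartedSpace H M]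
  {F : Type*} [NormedAddCommGroup F] [NormedSpace ℝ F]
  {V : M → Type*} [TopologicalSpace (TotalSpace F V)]
  [∀ x, AddCommGroup (V x)] [∀ x, Module ℝ (V x)] [∀ x, TopologicalSpace (V x)]
  [FiberBundle F V] [VectorBundle ℝ F V]

/-! If `∇` is torsion-free and Carrollian and `u` lies in `L`, then `[u, v] = ∇_u v - ∇_v u`, and
`∇_v u` lies in `L = ker g`. So `[u, v]` may be replaced by `∇_u v` inside `g`, and the Killing
equation becomes metric compatibility.

Conversely, the Koszul formula prescribes `g(∇_u v, w)`, but `g` is degenerate: a solution requires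
the right-hand side to vanish for `w` in `L`, and it is unique only up to `L`. For `w` in `L` the
right-hand side is `-½ (L_w g)(u, v)`, so solvability is exactly stationarity
(`koszul_eq_zero_of_isKilling`). The freedom along `L` is fixed by a one-form `τ` equal to `1` on a
frame of `L` (`exists_dual_apply_eq_one`), by imposing `τ(∇_u v) = ½ (ρ_u τ(v) + ρ_v τ(u) + τ([u,
v]))`. This expression has the Leibniz behaviour of a connection, and its skew part removes the
torsion along `L`. Both prescriptions together form one equation for the nondegenerate form `g + τ ⊗
τ`, solved by `exists_section_of_nondegenerate`. -/

@[simp]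
theorem smulSection_apply (f : C^∞⟮I, M; 𝓘(ℝ, ℝ), ℝ⟯) (v : Cₛ^∞⟮I; F, V⟯) (x : M) :
    smulSection f v x = f x • v x := rfl

theorem ContMDiffSection.finsetSum_apply {ι : Type*} (s : Finset ι)
    (e : ι → Cₛ^∞⟮I; F, V⟯) (x : M) : (∑ i ∈ s, e i) x = ∑ i ∈ s, e i x := by
  have h := map_sum (ContMDiffSection.coeAddHom I F ∞ V) e s
  simp only [ContMDiffSection.coeAddHom_apply] at h
  rw [h, Finset.sum_apply]

/-- Near every point there are global sections which form a frame there, and every section is,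
near that point, a combination of them with globally smooth coefficients. -/
theorem exists_globalSections_frame_nhds [IsManifold I ∞ M] [FiniteDimensional ℝ E] [T2Space M]
    [FiniteDimensional ℝ F] [ContMDiffVectorBundle ∞ F V I] (x₀ : M) :
    ∃ (e : Fin (Module.finrank ℝ F) → Cₛ^∞⟮I; F, V⟯) (U : Set M), U ∈ 𝓝 x₀ ∧
      (∀ y ∈ U, ∃ b : Module.Basis (Fin (Module.finrank ℝ F)) ℝ (V y), ∀ i, b i = e i y) ∧
      ∀ w : Cₛ^∞⟮I; F, V⟯, ∃ (f : C^∞⟮I, M; 𝓘(ℝ, ℝ), ℝ⟯)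
        (c : Fin (Module.finrank ℝ F) → C^∞⟮I, M; 𝓘(ℝ, ℝ), ℝ⟯),
        (∀ y ∈ U, f y = 1) ∧ smulSection f w = ∑ i, smulSection (c i) (e i) := by
  have : ContMDiffVectorBundle 1 F V I := ContMDiffVectorBundle.of_le (n := ∞) (by simp)
  let t := trivializationAt F V x₀
  have hx₀ : x₀ ∈ t.baseSet := FiberBundle.mem_baseSet_trivializationAt F V x₀
  obtain ⟨χ, -, hχ⟩ := (SmoothBumpFunction.nhds_basis_tsupport (I := I) x₀).mem_iff.1
    (t.open_baseSet.mem_nhds hx₀)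
  let b := Module.finBasis ℝ F
  have he (i) : ContMDiff I (I.prod 𝓘(ℝ, F)) ∞
      (fun x => TotalSpace.mk' F x (χ x • t.localFrame b i x)) :=
    ContMDiffOn.smul_section_of_tsupport χ.contMDiff.contMDiffOn t.open_baseSet hχ
      (t.contMDiffOn_localFrame_baseSet ∞ b i)
  refine ⟨fun i => ⟨_, he i⟩, {y | χ y = 1} ∩ t.baseSet, Filter.inter_mem χ.eventuallyEq_one
    (t.open_baseSet.mem_nhds hx₀), ?_, ?_⟩
  · rintro y ⟨hy, hyt⟩
    refine ⟨t.basisAt b hyt, fun i => ?_⟩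
    have : χ y = 1 := hy
    simp [this, hyt]
  · intro w
    have hc (i) : ContMDiff I 𝓘(ℝ, ℝ) ∞
        (fun x => χ x * (t.localFrameCoeff I b i x) (w x)) := by
      refine contMDiff_of_tsupport fun x hx => ?_
      have hx' : x ∈ t.baseSet := hχ (closure_mono (by
        intro y hy
        simp only [Function.mem_support] at hy ⊢
        exact left_ne_zero_of_mul hy) hx)
      exact χ.contMDiffAt.mul (contMDiffAt_localFrameCoeff b hx' w.contMDiff.contMDiffAt i)
    -- The square appears because both the frame and the coefficients have been cut off by `χ`.
    refine ⟨⟨fun x => χ x * χ x, χ.contMDiff.mul χ.contMDiff⟩, fun i => ⟨_, hc i⟩, ?_, ?_⟩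
    · rintro y ⟨hy, -⟩
      have : χ y = 1 := hy
      change χ y * χ y = 1
      simp [this]
    · ext x
      rw [ContMDiffSection.finsetSum_apply]
      change (χ x * χ x) • w x = ∑ i, (χ x * t.localFrameCoeff I b i x (w x)) •
        (χ x • t.localFrame b i x)
      by_cases hx : x ∈ t.baseSet
      · conv_lhs => rw [t.eq_sum_localFrameCoeff_smul (I := I) (b := b) (s := w) hx]
        rw [Finset.smul_sum]
        refine Finset.sum_congr rfl fun i _ => ?_
        simp only [smul_smul]
        congr 1
        ring
      · have : χ x = 0 := by
          by_contra h
          exact hx (hχ (subset_tsupport _ h))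
        simp [this]

/-- Every vector of a fibre is the value of a global section. -/
theorem exists_contMDiffSection_apply_eq [IsManifold I ∞ M] [FiniteDimensional ℝ E] [T2Space M]
    [FiniteDimensional ℝ F] [ContMDiffVectorBundle ∞ F V I] (x : M) (a : V x) :
    ∃ w : Cₛ^∞⟮I; F, V⟯, w x = a := by
  obtain ⟨e, U, hU, hb, -⟩ := exists_globalSections_frame_nhds (I := I) (F := F) (V := V) x
  obtain ⟨b, hb⟩ := hb x (mem_of_mem_nhds hU)
  refine ⟨∑ i, b.repr a i • e i, ?_⟩
  rw [ContMDiffSection.finsetSum_apply]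
  conv_rhs => rw [← b.sum_repr a]
  simp [hb]

theorem contMDiffAt_matrix_det {n : Type*} [Fintype n] [DecidableEq n] {A : M → Matrix n n ℝ}
    {x : M} (hA : ∀ i j, ContMDiffAt I 𝓘(ℝ, ℝ) ∞ (fun y => A y i j) x) :
    ContMDiffAt I 𝓘(ℝ, ℝ) ∞ (fun y => (A y).det) x := by
  simp only [Matrix.det_apply, Units.smul_def, zsmul_eq_mul]
  exact contMDiffAt_finsetSum fun σ _ =>
    contMDiffAt_const.mul (contMDiffAt_finsetProd fun i _ => hA _ _)

theorem contMDiffAt_matrix_inv {n : Type*} [Fintype n] [DecidableEq n] {A : M → Matrix n n ℝ}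
    {x : M} (hA : ∀ i j, ContMDiffAt I 𝓘(ℝ, ℝ) ∞ (fun y => A y i j) x) (hx : (A x).det ≠ 0)
    (i j : n) : ContMDiffAt I 𝓘(ℝ, ℝ) ∞ (fun y => (A y)⁻¹ i j) x := by
  simp only [Matrix.inv_def, Ring.inverse_eq_inv', Matrix.smul_apply, smul_eq_mul,
    Matrix.adjugate_apply]
  refine ((contMDiffAt_matrix_det hA).inv₀ hx).mul (contMDiffAt_matrix_det fun k l => ?_)
  simp only [Matrix.updateRow_apply]
  split_ifs
  · exact contMDiffAt_const
  · exact hA k l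

/-- A smooth nondegenerate bilinear form represents every `C^∞(M)`-linear functional on
sections. -/
theorem exists_section_of_nondegenerate [IsManifold I ∞ M] [FiniteDimensional ℝ E] [T2Space M]
    [FiniteDimensional ℝ F] [ContMDiffVectorBundle ∞ F V I]
    (G : ∀ x : M, V x →ₗ[ℝ] V x →ₗ[ℝ] ℝ)
    (hG : ∀ u v : Cₛ^∞⟮I; F, V⟯, ContMDiff I 𝓘(ℝ, ℝ) ∞ (fun x => G x (u x) (v x)))
    (hnd : ∀ (x : M) (a : V x), (∀ b, G x a b = 0) → a = 0)
    (φ : Cₛ^∞⟮I; F, V⟯ → M → ℝ) (hφ : ∀ w, ContMDiff I 𝓘(ℝ, ℝ) ∞ (φ w))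
    (hadd : ∀ v w x, φ (v + w) x = φ v x + φ w x)
    (hsmul : ∀ (f : C^∞⟮I, M; 𝓘(ℝ, ℝ), ℝ⟯) w x, φ (smulSection f w) x = f x * φ w x) :
    ∃ s : Cₛ^∞⟮I; F, V⟯, ∀ (w : Cₛ^∞⟮I; F, V⟯) x, G x (s x) (w x) = φ w x := by
  have key (x₀ : M) : ∃ s : ∀ x, V x,
      ContMDiffAt I (I.prod 𝓘(ℝ, F)) ∞ (fun x => TotalSpace.mk' F x (s x)) x₀ ∧
      ∀ᶠ y in 𝓝 x₀, ∀ w : Cₛ^∞⟮I; F, V⟯, G y (s y) (w y) = φ w y := by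
    obtain ⟨e, U, hU, hb, hw⟩ := exists_globalSections_frame_nhds (I := I) (F := F) (V := V) x₀
    -- The Gram matrix of the frame; a row relation would give a vector in the kernel of `G`.
    let A (y : M) : Matrix _ _ ℝ := Matrix.of fun i j => G y (e i y) (e j y)
    have hdet (y) (hy : y ∈ U) : (A y).det ≠ 0 := by
      obtain ⟨b, hb⟩ := hb y hy
      intro h0
      obtain ⟨v, hv, hv0⟩ := Matrix.exists_vecMul_eq_zero_iff.2 h0
      apply hv
      have : ∑ i, v i • b i = 0 := by
        apply hnd
        suffices h : G y (∑ i, v i • b i) = 0 by simp [h]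
        refine b.ext fun j => ?_
        have := congrFun hv0 j
        simpa [Matrix.vecMul, dotProduct, A, hb] using this
      exact funext (Fintype.linearIndependent_iff.1 b.linearIndependent v this)
    let c (y : M) := Matrix.vecMul (fun k => φ (e k) y) (A y)⁻¹
    refine ⟨fun y => ∑ i, c y i • e i y, ?_, ?_⟩
    · refine ContMDiffAt.sum_section fun i _ => ContMDiffAt.smul_section ?_
        (e i).contMDiff.contMDiffAt
      simp only [c, Matrix.vecMul, dotProduct]
      exact contMDiffAt_finsetSum fun k _ => (hφ (e k)).contMDiffAt.mul
        (contMDiffAt_matrix_inv (fun i j => (hG (e i) (e j)).contMDiffAt)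
          (hdet x₀ (mem_of_mem_nhds hU)) k i)
    · filter_upwards [hU] with y hy w
      obtain ⟨f, a, hf, hfw⟩ := hw w
      have hk (k) : G y (∑ i, c y i • e i y) (e k y) = φ (e k) y := by
        have h : Matrix.vecMul (c y) (A y) = fun k => φ (e k) y := by
          simp only [c]
          rw [Matrix.vecMul_vecMul, Matrix.nonsing_inv_mul _ (isUnit_iff_ne_zero.2 (hdet y hy)),
            Matrix.vecMul_one]
        have := congrFun h k
        simpa [Matrix.vecMul, dotProduct, A] using this
      have h1 : w y = ∑ i, a i y • e i y := by
        have := congrArg (fun s : Cₛ^∞⟮I; F, V⟯ => s y) hfw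
        simpa [ContMDiffSection.finsetSum_apply, hf y hy] using this
      -- As `f = 1` on `U`, `φ w` and `φ (f w)` agree there; this locality reduces `w` to the frame.
      have h2 : φ w y = ∑ i, a i y * φ (e i) y := by
        let ψ : Cₛ^∞⟮I; F, V⟯ →+ ℝ := AddMonoidHom.mk' (fun w => φ w y) (fun v w => hadd v w y)
        have := congrArg ψ hfw
        rw [map_sum] at this
        simpa [ψ, hsmul, hf y hy] using this
      rw [h1, h2, map_sum]
      simp only [map_smul, hk, smul_eq_mul]
  choose s hs hsw using key
  -- Local solutions are pointwise unique by nondegeneracy, so the diagonal `y ↦ s y y` agrees near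
  -- `x` with the smooth `s x`.
  refine ⟨⟨fun x => s x x, fun x => (hs x).congr_of_eventuallyEq ?_⟩,
    fun w x => (hsw x).self_of_nhds w⟩
  filter_upwards [hsw x] with y hy
  congr 1
  rw [← sub_eq_zero]
  refine hnd y _ fun b => ?_
  obtain ⟨w, rfl⟩ := exists_contMDiffSection_apply_eq (I := I) (F := F) y b
  rw [map_sub, LinearMap.sub_apply, hy w, (hsw y).self_of_nhds w, sub_self]

end Sections

end

noncomputable section

/-! ### A dual one-form, and derivation rules for the anchor and bracket. -/

section Algebroid

variable {E : Type*} [NormedAddCommGroup E] [NormedSpace ℝ E]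
  {H : Type*} [TopologicalSpace H] {I : ModelWithCorners ℝ E H}
  {M : Type*} [TopologicalSpace M] [ChartedSpace H M] [IsManifold I ∞ M]
  {F : Type*} [NormedAddCommGroup F] [NormedSpace ℝ F]
  {V : M → Type*} [TopologicalSpace (TotalSpace F V)]
  [∀ x, AddCommGroup (V x)] [∀ x, Module ℝ (V x)] [∀ x, TopologicalSpace (V x)]
  [FiberBundle F V] [VectorBundle ℝ F V]

/-- A nowhere vanishing section of a vector bundle is paired to `1` by some smooth section of the
dual bundle. -/
theorem exists_dual_apply_eq_one [FiniteDimensional ℝ E] [T2Space M] [SecondCountableTopology M]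
    [FiniteDimensional ℝ F] [ContMDiffVectorBundle ∞ F V I]
    (σ : Cₛ^∞⟮I; F, V⟯) (hσ : ∀ x, σ x ≠ 0) :
    ∃ τ : ∀ x, V x →L[ℝ] ℝ, (∀ x, τ x (σ x) = 1) ∧
      ∀ v : Cₛ^∞⟮I; F, V⟯, ContMDiff I 𝓘(ℝ, ℝ) ∞ (fun x => τ x (v x)) := by
  have : LocallyCompactSpace H := I.locallyCompactSpace
  have : LocallyCompactSpace M := ChartedSpace.locallyCompactSpace H M
  have hpair {s : ∀ x, V x →L[ℝ] Trivial M ℝ x} {U : Set M}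
      (hs : ContMDiffOn I (I.prod 𝓘(ℝ, F →L[ℝ] ℝ)) ∞ (fun x => TotalSpace.mk' (F →L[ℝ] ℝ)
        (E := fun x => V x →L[ℝ] Trivial M ℝ x) x (s x)) U) (v : Cₛ^∞⟮I; F, V⟯) :
      ContMDiffOn I 𝓘(ℝ, ℝ) ∞ (fun x => (s x (v x) : ℝ)) U := fun x hx =>
    contMDiffWithinAt_section.1 ((hs x hx).clm_bundle_apply (v.contMDiff x).contMDiffWithinAt)
  -- The condition `ℓ(σ) = 1` is affine, hence convex, so local solutions glue by a partition of
  -- unity.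
  obtain ⟨τ, hτ⟩ := exists_contMDiffSection_forall_mem_convex_of_local (n := ⊤)
    (F_fiber := F →L[ℝ] ℝ) I (fun x => V x →L[ℝ] Trivial M ℝ x)
    (fun x => {ℓ | (ℓ (σ x) : ℝ) = 1})
    (by
      intro x a ha b hb s t _ _ hst
      have ha' : (a (σ x) : ℝ) = 1 := ha
      have hb' : (b (σ x) : ℝ) = 1 := hb
      change s * (a (σ x) : ℝ) + t * (b (σ x) : ℝ) = 1
      rw [ha', hb']
      linarith)
    (by
      intro x₀
      let L := VectorBundle.continuousLinearEquivAt ℝ F V x₀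
      obtain ⟨φ, hφ⟩ := SeparatingDual.exists_ne_zero (R := ℝ) (x := L (σ x₀))
        (fun h => hσ x₀ (L.map_eq_zero_iff.1 h))
      let e := trivializationAt (F →L[ℝ] ℝ) (fun x => V x →L[ℝ] Trivial M ℝ x) x₀
      have hx₀ : x₀ ∈ e.baseSet := FiberBundle.mem_baseSet_trivializationAt _ _ x₀
      let ℓ : V x₀ →L[ℝ] Trivial M ℝ x₀ := φ.comp (L : V x₀ →L[ℝ] F)
      -- A functional nonzero on `σ x₀` is extended as a constant in the trivialization, then
      -- divided by its value on `σ` where that is nonzero.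
      let s (y : M) : V y →L[ℝ] Trivial M ℝ y := e.symm y (e ⟨x₀, ℓ⟩).2
      have hs : ContMDiffOn I (I.prod 𝓘(ℝ, F →L[ℝ] ℝ)) ∞ (fun x => TotalSpace.mk' (F →L[ℝ] ℝ)
          (E := fun x => V x →L[ℝ] Trivial M ℝ x) x (s x)) e.baseSet := by
        rw [e.contMDiffOn_section_baseSet_iff]
        refine (contMDiffOn_const (c := (e ⟨x₀, ℓ⟩).2)).congr fun y hy => ?_
        simp only [s]
        rw [e.apply_mk_symm hy]
      have hsx₀ : (s x₀ (σ x₀) : ℝ) ≠ 0 := by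
        have : s x₀ = ℓ := e.symm_apply_apply_mk hx₀ ℓ
        rw [this]
        exact hφ
      have hcont := (hpair hs σ).continuousOn
      refine ⟨e.baseSet ∩ (fun x => (s x (σ x) : ℝ)) ⁻¹' {0}ᶜ,
        (hcont.isOpen_inter_preimage e.open_baseSet isOpen_compl_singleton).mem_nhds
          ⟨hx₀, hsx₀⟩, fun y => (s y (σ y) : ℝ)⁻¹ • s y, ?_, ?_⟩
      · exact ContMDiffOn.smul_section
          (((hpair hs σ).mono Set.inter_subset_left).inv₀ fun y hy => hy.2)
          (hs.mono Set.inter_subset_left)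
      · rintro y ⟨-, hy⟩
        exact inv_mul_cancel₀ (a := (s y (σ y) : ℝ)) hy)
  refine ⟨τ, hτ, fun v => ?_⟩
  exact contMDiffOn_univ.1 (hpair τ.contMDiff.contMDiffOn v)

namespace LieAlgebroid

variable (A : LieAlgebroid I F V)

theorem contMDiff_anchorDeriv (u : Cₛ^∞⟮I; F, V⟯) {f : M → ℝ} (hf : ContMDiff I 𝓘(ℝ, ℝ) ∞ f) :
    ContMDiff I 𝓘(ℝ, ℝ) ∞ (A.anchorDeriv u f) := by
  have h1 : ContMDiff I I.tangent ∞
      (fun x => (TotalSpace.mk' E x (A.anchor x (u x)) : TangentBundle I M)) :=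
    A.contMDiff_anchor.clm_bundle_apply u.contMDiff
  have h2 := (contMDiff_snd_tangentBundle_modelSpace (n := ∞) ℝ 𝓘(ℝ, ℝ)).comp
    ((hf.contMDiff_tangentMap (m := ∞) (by simp)).comp h1)
  exact h2

theorem anchorDeriv_add_left (u v : Cₛ^∞⟮I; F, V⟯) (f : M → ℝ) (x : M) :
    A.anchorDeriv (u + v) f x = A.anchorDeriv u f x + A.anchorDeriv v f x := by
  simp [anchorDeriv]

theorem anchorDeriv_smulSection (f : C^∞⟮I, M; 𝓘(ℝ, ℝ), ℝ⟯) (u : Cₛ^∞⟮I; F, V⟯) (h : M → ℝ)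
    (x : M) : A.anchorDeriv (smulSection f u) h x = f x * A.anchorDeriv u h x := by
  simp [anchorDeriv]

theorem anchorDeriv_add (u : Cₛ^∞⟮I; F, V⟯) {f h : M → ℝ} (hf : ContMDiff I 𝓘(ℝ, ℝ) ∞ f)
    (hh : ContMDiff I 𝓘(ℝ, ℝ) ∞ h) (x : M) :
    A.anchorDeriv u (fun y => f y + h y) x = A.anchorDeriv u f x + A.anchorDeriv u h x := by
  simp only [anchorDeriv]
  rw [mvfderiv_fun_add (hf.mdifferentiableAt (by simp)) (hh.mdifferentiableAt (by simp))]
  rfl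

theorem anchorDeriv_mul (u : Cₛ^∞⟮I; F, V⟯) {f h : M → ℝ} (hf : ContMDiff I 𝓘(ℝ, ℝ) ∞ f)
    (hh : ContMDiff I 𝓘(ℝ, ℝ) ∞ h) (x : M) :
    A.anchorDeriv u (fun y => f y * h y) x =
      f x * A.anchorDeriv u h x + h x * A.anchorDeriv u f x := by
  simp only [anchorDeriv]
  rw [mvfderiv_fun_mul (hf.mdifferentiableAt (by simp)) (hh.mdifferentiableAt (by simp))]
  rfl

theorem anchorDeriv_const (u : Cₛ^∞⟮I; F, V⟯) (c : ℝ) (x : M) :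
    A.anchorDeriv u (fun _ => c) x = 0 := by
  simp [anchorDeriv, mvfderiv_const]

theorem bracket_skew (u v : Cₛ^∞⟮I; F, V⟯) : A.bracket u v = -A.bracket v u := by
  have h := A.bracket_self (u + v)
  simp only [map_add, LinearMap.add_apply, A.bracket_self, zero_add, add_zero] at h
  exact eq_neg_of_add_eq_zero_right h

theorem bracket_smulSection_right (f : C^∞⟮I, M; 𝓘(ℝ, ℝ), ℝ⟯) (u v : Cₛ^∞⟮I; F, V⟯) (x : M) :
    A.bracket u (smulSection f v) x = A.anchorDeriv u f x • v x + f x • A.bracket u v x :=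
  A.leibniz u v f x

theorem bracket_smulSection_left (f : C^∞⟮I, M; 𝓘(ℝ, ℝ), ℝ⟯) (u v : Cₛ^∞⟮I; F, V⟯) (x : M) :
    A.bracket (smulSection f u) v x = f x • A.bracket u v x - A.anchorDeriv v f x • u x := by
  rw [bracket_skew, A.bracket_skew u v]
  simp only [ContMDiffSection.coe_neg, Pi.neg_apply, bracket_smulSection_right]
  module

end LieAlgebroid

/-! ### The Koszul expression and its symmetries. -/

namespace SemiRiemannianLieAlgebroid

variable (A : SemiRiemannianLieAlgebroid I F V)

theorem contMDiff_g (u v : Cₛ^∞⟮I; F, V⟯) : ContMDiff I 𝓘(ℝ, ℝ) ∞ (A.g u v) := fun x =>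
  contMDiffAt_section _ |>.1 <|
    ContMDiffAt.clm_bundle_apply₂ (F₁ := F) (F₂ := F) (F₃ := ℝ) (E₃ := Trivial M ℝ)
      (A.contMDiff_metric x) (u.contMDiff x) (v.contMDiff x)

theorem g_symm (u v : Cₛ^∞⟮I; F, V⟯) : A.g u v = A.g v u :=
  funext fun x => A.metric_symm x (u x) (v x)

theorem g_add_left (u v w : Cₛ^∞⟮I; F, V⟯) : A.g (u + v) w = fun x => A.g u w x + A.g v w x := by
  ext x; simp [g]

theorem g_add_right (u v w : Cₛ^∞⟮I; F, V⟯) : A.g u (v + w) = fun x => A.g u v x + A.g u w x := by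
  ext x; simp [g]

theorem g_neg_left (u v : Cₛ^∞⟮I; F, V⟯) : A.g (-u) v = fun x => -A.g u v x := by
  ext x; simp [g]

theorem g_smulSection_left (f : C^∞⟮I, M; 𝓘(ℝ, ℝ), ℝ⟯) (u v : Cₛ^∞⟮I; F, V⟯) :
    A.g (smulSection f u) v = fun x => f x * A.g u v x := by
  ext x; simp [g]

theorem g_smulSection_right (f : C^∞⟮I, M; 𝓘(ℝ, ℝ), ℝ⟯) (u v : Cₛ^∞⟮I; F, V⟯) :
    A.g u (smulSection f v) = fun x => f x * A.g u v x := by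
  ext x; simp [g]

theorem g_bracket_smulSection_right (f : C^∞⟮I, M; 𝓘(ℝ, ℝ), ℝ⟯) (u v w : Cₛ^∞⟮I; F, V⟯) (x : M) :
    A.g (A.bracket u (smulSection f v)) w x =
      A.anchorDeriv u f x * A.g v w x + f x * A.g (A.bracket u v) w x := by
  simp [g, LieAlgebroid.bracket_smulSection_right]

theorem g_bracket_smulSection_left (f : C^∞⟮I, M; 𝓘(ℝ, ℝ), ℝ⟯) (u v w : Cₛ^∞⟮I; F, V⟯) (x : M) :
    A.g (A.bracket (smulSection f u) v) w x =
      f x * A.g (A.bracket u v) w x - A.anchorDeriv v f x * A.g u w x := by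
  simp [g, LieAlgebroid.bracket_smulSection_left]

/-- The right-hand side of the Koszul formula for `g(∇_u v, w)`. -/
def koszul (u v w : Cₛ^∞⟮I; F, V⟯) : M → ℝ := fun x =>
  2⁻¹ * (A.anchorDeriv u (A.g v w) x + A.anchorDeriv v (A.g u w) x - A.anchorDeriv w (A.g u v) x
    + A.g (A.bracket u v) w x - A.g (A.bracket u w) v x - A.g (A.bracket v w) u x)

theorem contMDiff_koszul (u v w : Cₛ^∞⟮I; F, V⟯) : ContMDiff I 𝓘(ℝ, ℝ) ∞ (A.koszul u v w) :=
  contMDiff_const.mul ((((((A.contMDiff_anchorDeriv _ (A.contMDiff_g _ _)).add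
    (A.contMDiff_anchorDeriv _ (A.contMDiff_g _ _))).sub
    (A.contMDiff_anchorDeriv _ (A.contMDiff_g _ _))).add (A.contMDiff_g _ _)).sub
    (A.contMDiff_g _ _)).sub (A.contMDiff_g _ _))

theorem koszul_add_left (u u' v w : Cₛ^∞⟮I; F, V⟯) (x : M) :
    A.koszul (u + u') v w x = A.koszul u v w x + A.koszul u' v w x := by
  simp only [koszul, map_add, LinearMap.add_apply, g_add_left, g_add_right,
    A.anchorDeriv_add_left, A.anchorDeriv_add _ (A.contMDiff_g _ _) (A.contMDiff_g _ _)]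
  ring

theorem koszul_add_middle (u v v' w : Cₛ^∞⟮I; F, V⟯) (x : M) :
    A.koszul u (v + v') w x = A.koszul u v w x + A.koszul u v' w x := by
  simp only [koszul, map_add, LinearMap.add_apply, g_add_left, g_add_right,
    A.anchorDeriv_add_left, A.anchorDeriv_add _ (A.contMDiff_g _ _) (A.contMDiff_g _ _)]
  ring

theorem koszul_add_right (u v w w' : Cₛ^∞⟮I; F, V⟯) (x : M) :
    A.koszul u v (w + w') x = A.koszul u v w x + A.koszul u v w' x := by
  simp only [koszul, map_add, g_add_left, g_add_right,
    A.anchorDeriv_add_left, A.anchorDeriv_add _ (A.contMDiff_g _ _) (A.contMDiff_g _ _)]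
  ring

theorem koszul_smulSection_left (f : C^∞⟮I, M; 𝓘(ℝ, ℝ), ℝ⟯) (u v w : Cₛ^∞⟮I; F, V⟯) (x : M) :
    A.koszul (smulSection f u) v w x = f x * A.koszul u v w x := by
  simp only [koszul, g_smulSection_left, g_smulSection_right, A.anchorDeriv_smulSection,
    A.anchorDeriv_mul _ f.contMDiff (A.contMDiff_g _ _), g_bracket_smulSection_left]
  ring

theorem koszul_smulSection_middle (f : C^∞⟮I, M; 𝓘(ℝ, ℝ), ℝ⟯) (u v w : Cₛ^∞⟮I; F, V⟯) (x : M) :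
    A.koszul u (smulSection f v) w x = f x * A.koszul u v w x + A.anchorDeriv u f x * A.g v w x := by
  simp only [koszul, g_smulSection_left, g_smulSection_right, A.anchorDeriv_smulSection,
    A.anchorDeriv_mul _ f.contMDiff (A.contMDiff_g _ _), g_bracket_smulSection_left,
    g_bracket_smulSection_right]
  rw [A.g_symm v u]
  ring

/-- All derivatives of `f` cancel: this tensoriality in `w` lets the expression be represented by a
section. -/
theorem koszul_smulSection_right (f : C^∞⟮I, M; 𝓘(ℝ, ℝ), ℝ⟯) (u v w : Cₛ^∞⟮I; F, V⟯) (x : M) :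
    A.koszul u v (smulSection f w) x = f x * A.koszul u v w x := by
  simp only [koszul, g_smulSection_right, A.anchorDeriv_smulSection,
    A.anchorDeriv_mul _ f.contMDiff (A.contMDiff_g _ _), g_bracket_smulSection_right]
  rw [A.g_symm w v, A.g_symm w u]
  ring

/-- Becomes metric compatibility of the connection. -/
theorem koszul_add_koszul_swap (u v w : Cₛ^∞⟮I; F, V⟯) (x : M) :
    A.koszul u v w x + A.koszul u w v x = A.anchorDeriv u (A.g v w) x := by
  simp only [koszul]
  rw [A.bracket_skew w v, A.g_symm w v, A.g_neg_left]
  ring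

/-- Becomes vanishing of the torsion modulo `L`. -/
theorem koszul_sub_koszul_swap (u v w : Cₛ^∞⟮I; F, V⟯) (x : M) :
    A.koszul u v w x - A.koszul v u w x = A.g (A.bracket u v) w x := by
  simp only [koszul]
  rw [A.bracket_skew v u, A.g_symm v u, A.g_neg_left]
  ring

/-- Terms pairing with `w` drop out, and what remains is `-½ (L_w g)(u, v)`. -/
theorem koszul_eq_zero_of_isKilling {u v w : Cₛ^∞⟮I; F, V⟯} (hw : A.IsKilling w)
    (hker : ∀ v, A.g v w = fun _ => 0) (x : M) : A.koszul u v w x = 0 := by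
  have h := congrFun (hw u v) x
  simp only [lieDerivMetric, Pi.sub_apply, Pi.zero_apply] at h
  rw [A.bracket_skew w u, A.bracket_skew w v, A.g_neg_left, A.g_symm u (-_), A.g_neg_left] at h
  dsimp only at h
  simp only [koszul, hker, A.anchorDeriv_const]
  linarith

end SemiRiemannianLieAlgebroid

/-- The symmetrised derivative of a one-form `τ`, corrected so as to differ from its transpose
by `τ([u, v])`. -/
def LieAlgebroid.symmDeriv (A : LieAlgebroid I F V) (τ : ∀ x, V x →L[ℝ] ℝ)
    (u v : Cₛ^∞⟮I; F, V⟯) : M → ℝ := fun x =>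
  2⁻¹ * (A.anchorDeriv u (fun y => τ y (v y)) x + A.anchorDeriv v (fun y => τ y (u y)) x
    + τ x (A.bracket u v x))

namespace LieAlgebroid

variable (A : LieAlgebroid I F V) {τ : ∀ x, V x →L[ℝ] ℝ}

theorem contMDiff_symmDeriv
    (hτ : ∀ v : Cₛ^∞⟮I; F, V⟯, ContMDiff I 𝓘(ℝ, ℝ) ∞ (fun x => τ x (v x)))
    (u v : Cₛ^∞⟮I; F, V⟯) :
    ContMDiff I 𝓘(ℝ, ℝ) ∞ (A.symmDeriv τ u v) :=
  contMDiff_const.mul (((A.contMDiff_anchorDeriv _ (hτ _)).add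
    (A.contMDiff_anchorDeriv _ (hτ _))).add (hτ _))

theorem symmDeriv_add_left
    (hτ : ∀ v : Cₛ^∞⟮I; F, V⟯, ContMDiff I 𝓘(ℝ, ℝ) ∞ (fun x => τ x (v x)))
    (u u' v : Cₛ^∞⟮I; F, V⟯) (x : M) :
    A.symmDeriv τ (u + u') v x = A.symmDeriv τ u v x + A.symmDeriv τ u' v x := by
  simp only [symmDeriv, map_add, LinearMap.add_apply, ContMDiffSection.coe_add, Pi.add_apply,
    A.anchorDeriv_add_left, A.anchorDeriv_add _ (hτ _) (hτ _)]
  ring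

theorem symmDeriv_add_right
    (hτ : ∀ v : Cₛ^∞⟮I; F, V⟯, ContMDiff I 𝓘(ℝ, ℝ) ∞ (fun x => τ x (v x)))
    (u v v' : Cₛ^∞⟮I; F, V⟯) (x : M) :
    A.symmDeriv τ u (v + v') x = A.symmDeriv τ u v x + A.symmDeriv τ u v' x := by
  simp only [symmDeriv, map_add, ContMDiffSection.coe_add, Pi.add_apply,
    A.anchorDeriv_add_left, A.anchorDeriv_add _ (hτ _) (hτ _)]
  ring

/-- The term `ρ_v(f) τ(u)` from differentiating `τ(f u)` cancels against the one from `[f u, v]`. -/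
theorem symmDeriv_smulSection_left
    (hτ : ∀ v : Cₛ^∞⟮I; F, V⟯, ContMDiff I 𝓘(ℝ, ℝ) ∞ (fun x => τ x (v x)))
    (f : C^∞⟮I, M; 𝓘(ℝ, ℝ), ℝ⟯) (u v : Cₛ^∞⟮I; F, V⟯) (x : M) :
    A.symmDeriv τ (smulSection f u) v x = f x * A.symmDeriv τ u v x := by
  simp only [symmDeriv, smulSection_apply, map_smul, smul_eq_mul, A.anchorDeriv_smulSection,
    A.anchorDeriv_mul _ f.contMDiff (hτ _), bracket_smulSection_left, map_sub]
  ring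

theorem symmDeriv_smulSection_right
    (hτ : ∀ v : Cₛ^∞⟮I; F, V⟯, ContMDiff I 𝓘(ℝ, ℝ) ∞ (fun x => τ x (v x)))
    (f : C^∞⟮I, M; 𝓘(ℝ, ℝ), ℝ⟯) (u v : Cₛ^∞⟮I; F, V⟯) (x : M) :
    A.symmDeriv τ u (smulSection f v) x =
      f x * A.symmDeriv τ u v x + A.anchorDeriv u f x * τ x (v x) := by
  simp only [symmDeriv, smulSection_apply, map_smul, smul_eq_mul, A.anchorDeriv_smulSection,
    A.anchorDeriv_mul _ f.contMDiff (hτ _), bracket_smulSection_right, map_add]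
  ring

theorem symmDeriv_sub_symmDeriv_swap (u v : Cₛ^∞⟮I; F, V⟯) (x : M) :
    A.symmDeriv τ u v x - A.symmDeriv τ v u x = τ x (A.bracket u v x) := by
  simp only [symmDeriv]
  rw [A.bracket_skew v u]
  simp only [ContMDiffSection.coe_neg, Pi.neg_apply, map_neg]
  ring

end LieAlgebroid

end Algebroid

end

noncomputable section

/-! ### Both directions of the equivalence. -/

section Connection

variable {E : Type*} [NormedAddCommGroup E] [NormedSpace ℝ E]
  {H : Type*} [TopologicalSpace H] {I : ModelWithCorners ℝ E H}
  {M : Type*} [TopologicalSpace M] [ChartedSpace H M] [IsManifold I ∞ M]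
  {F : Type*} [NormedAddCommGroup F] [NormedSpace ℝ F]
  {V : M → Type*} [TopologicalSpace (TotalSpace F V)]
  [∀ x, AddCommGroup (V x)] [∀ x, Module ℝ (V x)] [∀ x, TopologicalSpace (V x)]
  [FiberBundle F V] [VectorBundle ℝ F V]

namespace CarrollianLieAlgebroid

variable (A : CarrollianLieAlgebroid I F V)

theorem g_eq_zero_of_mem_secL (v : Cₛ^∞⟮I; F, V⟯) {w : Cₛ^∞⟮I; F, V⟯} (hw : w ∈ A.secL) :
    A.g v w = fun _ => 0 := by
  ext x
  exact (A.metric_symm x _ _).trans ((A.ker_metric x (w x)).2 (hw x) (v x))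

theorem isStationary_of_isTorsionFree (D : A.toLieAlgebroid.Connection) (hD : A.IsCarrollian D)
    (hT : D.IsTorsionFree) : A.IsStationary := by
  intro u hu v w
  have hb (v : Cₛ^∞⟮I; F, V⟯) : A.bracket u v = D.nabla u v - D.nabla v u :=
    (sub_eq_zero.1 (hT u v)).symm
  have h0 (v w : Cₛ^∞⟮I; F, V⟯) (x : M) : A.metric x (D.nabla v u x) (w x) = 0 :=
    (A.ker_metric x _).2 (hD.1 v u hu x) _
  ext x
  have hm := congrFun (hD.2 u v w) x
  simp only [SemiRiemannianLieAlgebroid.lieDerivMetric, Pi.sub_apply, Pi.zero_apply, hm,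
    Pi.add_apply, hb, SemiRiemannianLieAlgebroid.g, ContMDiffSection.coe_sub, map_sub,
    sub_apply, h0]
  rw [A.metric_symm x (v x) (D.nabla w u x), h0]
  ring

/-- The nondegenerate form `g + τ ⊗ τ`. -/
def extendedMetric (τ : ∀ x, V x →L[ℝ] ℝ) (x : M) : V x →ₗ[ℝ] V x →ₗ[ℝ] ℝ :=
  LinearMap.mk₂ ℝ (fun a b => A.metric x a b + τ x a * τ x b)
    (fun _ _ _ => by simp only [map_add, add_apply]; ring)
    (fun _ _ _ => by simp only [map_smul, smul_apply, smul_eq_mul]; ring)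
    (fun _ _ _ => by simp only [map_add]; ring)
    (fun _ _ _ => by simp only [map_smul, smul_eq_mul]; ring)

theorem extendedMetric_apply (τ : ∀ x, V x →L[ℝ] ℝ) (x : M) (a b : V x) :
    A.extendedMetric τ x a b = A.metric x a b + τ x a * τ x b := rfl

theorem metric_eq_zero_of_mem_right {x : M} (a : V x) {b : V x} (hb : b ∈ A.L x) :
    A.metric x a b = 0 :=
  (A.metric_symm x a b).trans ((A.ker_metric x b).2 hb a)

/-- Pairing with `s` gives `τ(a) = 0`, so `a` lies in `ker g = L`, on which `τ` is injective. -/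
theorem eq_zero_of_extendedMetric_eq_zero {τ : ∀ x, V x →L[ℝ] ℝ} {x : M} {s : V x}
    (hs : A.L x = Submodule.span ℝ {s}) (hτ : τ x s = 1) {a : V x}
    (ha : ∀ b, A.extendedMetric τ x a b = 0) : a = 0 := by
  have hτa : τ x a = 0 := by
    have := ha s
    rwa [extendedMetric_apply, hτ, A.metric_eq_zero_of_mem_right a
      (hs ▸ Submodule.mem_span_singleton_self s), zero_add, mul_one] at this
  have : a ∈ A.L x := (A.ker_metric x a).1 fun b => by
    simpa [extendedMetric_apply, hτa] using ha b
  rw [hs] at this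
  obtain ⟨c, rfl⟩ := Submodule.mem_span_singleton.1 this
  rw [map_smul, hτ, smul_eq_mul, mul_one] at hτa
  rw [hτa, zero_smul]

/-- In a stationary Carrollian Lie algebroid, the Koszul formula together with a one-form `τ`
which is `1` on a frame of `L` determines a torsion-free Carrollian connection. -/
theorem exists_isTorsionFree_of_isStationary [FiniteDimensional ℝ E] [T2Space M]
    [SecondCountableTopology M] [FiniteDimensional ℝ F] [ContMDiffVectorBundle ∞ F V I]
    (hA : A.IsStationary) :
    ∃ D : A.toLieAlgebroid.Connection, A.IsCarrollian D ∧ D.IsTorsionFree := by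
  obtain ⟨σ, hσ⟩ := A.isTrivialLineSubbundle_L
  obtain ⟨τ, hτσ, hτ⟩ := exists_dual_apply_eq_one σ fun x => (hσ x).1
  have hσL : σ ∈ A.secL := fun x => (hσ x).2 ▸ Submodule.mem_span_singleton_self (σ x)
  have hnd (x : M) (a : V x) (ha : ∀ b, A.extendedMetric τ x a b = 0) : a = 0 :=
    A.eq_zero_of_extendedMetric_eq_zero (hσ x).2 (hτσ x) ha
  have hex (u v : Cₛ^∞⟮I; F, V⟯) : ∃ s : Cₛ^∞⟮I; F, V⟯, ∀ (w : Cₛ^∞⟮I; F, V⟯) x,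
      A.extendedMetric τ x (s x) (w x) =
        A.koszul u v w x + A.symmDeriv τ u v x * τ x (w x) := by
    refine exists_section_of_nondegenerate (A.extendedMetric τ) (fun u v => ?_) hnd
      (fun w x => A.koszul u v w x + A.symmDeriv τ u v x * τ x (w x)) (fun w => ?_)
      (fun w w' x => ?_) (fun f w x => ?_)
    · exact (A.contMDiff_g u v).add ((hτ u).mul (hτ v))
    · exact (A.contMDiff_koszul u v w).add ((A.contMDiff_symmDeriv hτ u v).mul (hτ w))
    · simp only [A.koszul_add_right, ContMDiffSection.coe_add, Pi.add_apply, map_add]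
      ring
    · simp only [A.koszul_smulSection_right, smulSection_apply, map_smul, smul_eq_mul]
      ring
  choose N hN using hex
  have hext {x : M} {a b : V x} (h : ∀ w : Cₛ^∞⟮I; F, V⟯,
      A.extendedMetric τ x a (w x) = A.extendedMetric τ x b (w x)) : a = b := by
    rw [← sub_eq_zero]
    refine hnd x _ fun c => ?_
    obtain ⟨w, rfl⟩ := exists_contMDiffSection_apply_eq (I := I) (F := F) x c
    rw [map_sub, LinearMap.sub_apply, h w, sub_self]
  -- Testing on `σ` isolates the `τ`-component, since stationarity makes the Koszul term vanish
  -- there; subtracting it leaves the pure Koszul formula for `g`.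
  have hτN (u v : Cₛ^∞⟮I; F, V⟯) (x : M) : τ x (N u v x) = A.symmDeriv τ u v x := by
    have h := hN u v σ x
    rwa [A.koszul_eq_zero_of_isKilling (hA σ hσL) (fun v => A.g_eq_zero_of_mem_secL v hσL),
      extendedMetric_apply, A.metric_eq_zero_of_mem_right _ (hσL x), hτσ, mul_one, mul_one,
      zero_add, zero_add] at h
  have hgN (u v w : Cₛ^∞⟮I; F, V⟯) (x : M) : A.metric x (N u v x) (w x) = A.koszul u v w x := by
    have h := hN u v w x
    rwa [extendedMetric_apply, hτN, add_left_inj] at h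
  have hadd_left (u u' v : Cₛ^∞⟮I; F, V⟯) : N (u + u') v = N u v + N u' v := by
    ext x
    refine hext fun w => ?_
    simp only [hN, A.koszul_add_left, A.symmDeriv_add_left hτ, ContMDiffSection.coe_add,
      Pi.add_apply, map_add, LinearMap.add_apply]
    ring
  have hadd_right (u v v' : Cₛ^∞⟮I; F, V⟯) : N u (v + v') = N u v + N u v' := by
    ext x
    refine hext fun w => ?_
    simp only [hN, A.koszul_add_middle, A.symmDeriv_add_right hτ, ContMDiffSection.coe_add,
      Pi.add_apply, map_add, LinearMap.add_apply]
    ring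
  have hsmul_left (f : C^∞⟮I, M; 𝓘(ℝ, ℝ), ℝ⟯) (u v : Cₛ^∞⟮I; F, V⟯) :
      N (smulSection f u) v = smulSection f (N u v) := by
    ext x
    refine hext fun w => ?_
    simp only [hN, A.koszul_smulSection_left, A.symmDeriv_smulSection_left hτ, smulSection_apply,
      map_smul, LinearMap.smul_apply, smul_eq_mul]
    ring
  have hsmul_right (f : C^∞⟮I, M; 𝓘(ℝ, ℝ), ℝ⟯) (u v : Cₛ^∞⟮I; F, V⟯) (x : M) :
      N u (smulSection f v) x = f x • N u v x + A.anchorDeriv u f x • v x := by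
    refine hext fun w => ?_
    simp only [hN, A.koszul_smulSection_middle, A.symmDeriv_smulSection_right hτ,
      map_smul, LinearMap.smul_apply, map_add, LinearMap.add_apply, smul_eq_mul]
    rw [extendedMetric_apply, SemiRiemannianLieAlgebroid.g]
    ring
  let D : A.toLieAlgebroid.Connection :=
    { nabla := LinearMap.mk₂ ℝ N hadd_left
        -- Real scalars are treated as constant functions, whose anchor derivative vanishes.
        (fun r u v => hsmul_left (ContMDiffMap.const r) u v)
        hadd_right
        (fun r u v => by
          ext x
          refine (hsmul_right (ContMDiffMap.const r) u v x).trans ?_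
          change r • N u v x + A.anchorDeriv u (fun _ => r) x • v x = r • N u v x
          rw [A.anchorDeriv_const, zero_smul, add_zero])
      nabla_smul_left := hsmul_left
      nabla_smul_right := hsmul_right }
  refine ⟨D, ⟨fun u v hv x => (A.ker_metric x _).1 fun b => ?_, fun u v w => ?_⟩, fun u v => ?_⟩
  · obtain ⟨w, rfl⟩ := exists_contMDiffSection_apply_eq (I := I) (F := F) x b
    change A.metric x (N u v x) (w x) = 0
    -- Swapping `v` and `w` moves `v` to the last slot, where being Killing and in `L` makes the
    -- expression vanish; `ρ_u(g(v, w))` is zero as well.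
    have h := A.koszul_add_koszul_swap u v w x
    rwa [A.koszul_eq_zero_of_isKilling (hA v hv) (fun v' => A.g_eq_zero_of_mem_secL v' hv),
      A.g_symm v w, A.g_eq_zero_of_mem_secL w hv, A.anchorDeriv_const, add_zero, ← hgN] at h
  · ext x
    change _ = A.metric x (N u v x) (w x) + A.metric x (v x) (N u w x)
    rw [A.metric_symm x (v x), hgN, hgN, A.koszul_add_koszul_swap]
  · refine sub_eq_zero.2 ?_
    ext x
    refine hext fun w => ?_
    change A.extendedMetric τ x (N u v x - N v u x) (w x) = _
    rw [map_sub, LinearMap.sub_apply, hN, hN, extendedMetric_apply,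
      ← A.symmDeriv_sub_symmDeriv_swap]
    have h := A.koszul_sub_koszul_swap u v w x
    rw [SemiRiemannianLieAlgebroid.g] at h
    linarith

end CarrollianLieAlgebroid

end Connection

end

/-- Let `M` be a smooth manifold and `V → M` a smooth vector bundle of finite rank. A Carrollian
Lie algebroid structure on `V` admits a torsion-free Carrollian connection if and only if it is
stationary. -/
theorem mainTheorem2
    {E : Type*} [NormedAddCommGroup E] [NormedSpace ℝ E] [FiniteDimensional ℝ E]
    {H : Type*} [TopologicalSpace H] {I : ModelWithCorners ℝ E H}
    {M : Type*} [TopologicalSpace M] [ChartedSpace H M] [IsManifold I ∞ M]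
    [BoundarylessManifold I M] [T2Space M] [SecondCountableTopology M]
    {F : Type*} [NormedAddCommGroup F] [NormedSpace ℝ F] [FiniteDimensional ℝ F]
    {V : M → Type*} [TopologicalSpace (TotalSpace F V)]
    [∀ x, AddCommGroup (V x)] [∀ x, Module ℝ (V x)] [∀ x, TopologicalSpace (V x)]
    [∀ x, IsTopologicalAddGroup (V x)] [∀ x, ContinuousSMul ℝ (V x)]
    [FiberBundle F V] [VectorBundle ℝ F V] [ContMDiffVectorBundle ∞ F V I]
    (A : CarrollianLieAlgebroid I F V) :
    (∃ D : A.toLieAlgebroid.Connection, A.IsCarrollian D ∧ D.IsTorsionFree) ↔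
      A.IsStationary :=
  ⟨fun ⟨D, hD, hT⟩ => A.isStationary_of_isTorsionFree D hD hT,
    A.exists_isTorsionFree_of_isStationary⟩
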